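/- Let $E=(E^0,E^1,r,s)$ be a directed graph, where $E^0$ and $E^1$ are arbitrary sets (of any cardinality) and $r,s:E^1\to E^0$ are arbitrary maps. For $v,w\in E^0$ write $v\geq w$ if there is a path (a finite sequence of edges $e_1\cdots e_n$ with $r(e_i)=s(e_{i+1})$, or a single vertex as a path of length $0$) from $v$ to $w$, and put $U(w):=\{v\in E^0 : v\geq w\}$. The graph $E$ satisfies the *Countable Separation Property* if there is a countable set $X\subseteq E^0$ with $E^0=\bigcup_{x\in X}U(x)$. Let $C^*(E)$ be the graph $C^*$-algebra of $E$, that is, the universal $C^*$-algebra generated by mutually orthogonal projections $\{p_v : v\in E^0\}$ and partial isometries $\{s_e : e\in E^1\}$ with mutually orthogonal ranges such that $s_e^*s_e=p_{r(e)}$ and $s_es_e^*\leq p_{s(e)}$ for all $e\in E^1$, and $p_v=\sum_{s(e)=v}s_es_e^*$ for every $v\in E^0$ with $0<|s^{-1}(v)|<\infty$. A *$*$-representation* of a $C^*$-algebra $A$ is a $*$-homomorphism $\pi:A\to B(\mathcal H)$ for some complex Hilbert space $\mathcal H$; it is *faithful* if it is injective. For $S\subseteq\mathcal H$ let $\pi(A)S:=\overline{\operatorname{span}}\{\pi(a)h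 : a\in A,\ h\in S\}$. The representation $\pi$ is *countably generated* if $\pi(A)S=\mathcal H$ for some countable $S\subseteq\mathcal H$, *cyclic* if $\pi(A)\{h\}=\mathcal H$ for some $h\in\mathcal H$, and *irreducible* if $\mathcal H$ has no closed $\pi$-invariant subspaces other than $\{0\}$ and $\mathcal H$. The algebra $A$ is *primitive* if it has a faithful irreducible $*$-representation. Then: 1. If $C^*(E)$ has a faithful countably generated $*$-representation, then $E$ satisfies the Countable Separation Property. 2. If $C^*(E)$ has a faithful cyclic $*$-representation, then $E$ satisfies the Countable Separation Property. 3. If $C^*(E)$ is primitive, then $E$ satisfies the Countable Separation Property. -/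

import Mathlib

open scoped ENNReal

universe u v w x

/-- A directed graph `(E⁰, E¹, r, s)` with vertex set `V` and edge set `E`, both of arbitrary
cardinality; loops and parallel edges are allowed. -/
structure DirectedGraph (V : Type u) (E : Type v) where
  /-- the source map -/
  src : E → V
  /-- the range map -/
  rng : E → V

namespace DirectedGraph

variable {V : Type u} {E : Type v}

/-- `G.IsPath v α w`: the list of edges `α = e₁ e₂ … eₙ` is a path with source `v` and range `w`,
i.e. `s(e₁) = v`, `r(eᵢ) = s(eᵢ₊₁)` and `r(eₙ) = w`. The empty list is the path of length zero at
`v`, with `r(v) = s(v) = v`. -/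
def IsPath (G : DirectedGraph V E) : V → List E → V → Prop
  | v, [], w => v = w
  | v, e :: α, w => G.src e = v ∧ G.IsPath (G.rng e) α w

/-- `v ≥ w`: there is a path from `v` to `w`. -/
def Reaches (G : DirectedGraph V E) (v w : V) : Prop := ∃ α : List E, G.IsPath v α w

/-- `U(w)`, the set of the vertices `v` with `v ≥ w`. -/
def U (G : DirectedGraph V E) (w : V) : Set V := {v | G.Reaches v w}

/-- The Countable Separation Property: `E⁰ = ⋃_{x ∈ X} U(x)` for some countable `X ⊆ E⁰`. -/
def CountableSeparationProperty (G : DirectedGraph V E) : Prop :=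
  ∃ X : Set V, X.Countable ∧ ⋃ x ∈ X, G.U x = Set.univ

/-- A Cuntz-Krieger `G`-family in a C⋆-algebra `A`. The relation `s_e s_e^* ≤ p_{s(e)}` between
projections is written as `p_{s(e)} (s_e s_e^*) = s_e s_e^*`; see `CuntzKriegerFamily.range_le`. -/
structure CuntzKriegerFamily (G : DirectedGraph V E) (A : Type w) [NonUnitalCStarAlgebra A] where
  /-- the vertex projections -/
  p : V → A
  /-- the edge partial isometries -/
  s : E → A
  isStarProjection_p : ∀ v, IsStarProjection (p v)
  p_mul_p : ∀ v v', v ≠ v' → p v * p v' = 0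
  partialIsometry_s : ∀ e, s e * star (s e) * s e = s e
  range_mul_range : ∀ e f, e ≠ f → (s e * star (s e)) * (s f * star (s f)) = 0
  star_s_mul_s : ∀ e, star (s e) * s e = p (G.rng e)
  p_mul_range : ∀ e, p (G.src e) * (s e * star (s e)) = s e * star (s e)
  /-- the relation at the regular vertices, those that emit a nonzero finite number of edges -/
  sum_range : ∀ v (h : {e | G.src e = v}.Finite), {e | G.src e = v}.Nonempty →
    p v = ∑ e ∈ h.toFinset, s e * star (s e)

namespace CuntzKriegerFamily

variable {G : DirectedGraph V E} {A : Type w} [NonUnitalCStarAlgebra A]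

lemma isStarProjection_range (F : CuntzKriegerFamily G A) (e : E) :
    IsStarProjection (F.s e * star (F.s e)) where
  isIdempotentElem := by
    change F.s e * star (F.s e) * (F.s e * star (F.s e)) = _
    rw [← mul_assoc, F.partialIsometry_s]
  isSelfAdjoint := .mul_star_self _

/-- The relation `s_e s_e^* ≤ p_{s(e)}` in the order of the C⋆-algebra. -/
lemma range_le [PartialOrder A] [StarOrderedRing A] (F : CuntzKriegerFamily G A) (e : E) :
    F.s e * star (F.s e) ≤ F.p (G.src e) :=
  ((F.isStarProjection_range e).le_iff_mul_eq_right (F.isStarProjection_p _)).2 (F.p_mul_range e)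

lemma norm_p_le (F : CuntzKriegerFamily G A) (v : V) : ‖F.p v‖ ≤ 1 := by
  have h : ‖F.p v‖ = ‖F.p v‖ * ‖F.p v‖ := by
    rw [← CStarRing.norm_star_mul_self, (F.isStarProjection_p v).isSelfAdjoint.star_eq,
      (F.isStarProjection_p v).isIdempotentElem.eq]
  nlinarith [norm_nonneg (F.p v)]

lemma norm_s_le (F : CuntzKriegerFamily G A) (e : E) : ‖F.s e‖ ≤ 1 := by
  have h : ‖F.s e‖ * ‖F.s e‖ = ‖F.p (G.rng e)‖ := by
    rw [← CStarRing.norm_star_mul_self, F.star_s_mul_s]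
  nlinarith [norm_nonneg (F.s e), F.norm_p_le (G.rng e)]

/-- Elements that an injective ⋆-homomorphism sends to a Cuntz-Krieger family form such a family. -/
def comap {B : Type x} [NonUnitalCStarAlgebra B] (F : CuntzKriegerFamily G B) (φ : A →⋆ₙₐ[ℂ] B)
    (hφ : Function.Injective φ) (p : V → A) (s : E → A) (hp : ∀ v, φ (p v) = F.p v)
    (hs : ∀ e, φ (s e) = F.s e) : CuntzKriegerFamily G A where
  p := p
  s := s
  isStarProjection_p v :=
    { isIdempotentElem := hφ <| by
        rw [map_mul, hp, (F.isStarProjection_p v).isIdempotentElem.eq]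
      isSelfAdjoint := hφ <| by
        rw [map_star, hp, (F.isStarProjection_p v).isSelfAdjoint.star_eq] }
  p_mul_p v v' h := hφ <| by rw [map_mul, hp, hp, F.p_mul_p v v' h, map_zero]
  partialIsometry_s e := hφ <| by simp only [map_mul, map_star, hs, F.partialIsometry_s]
  range_mul_range e f h := hφ <| by
    simp only [map_mul, map_star, hs, F.range_mul_range e f h, map_zero]
  star_s_mul_s e := hφ <| by simp only [map_mul, map_star, hs, hp, F.star_s_mul_s]
  p_mul_range e := hφ <| by simp only [map_mul, map_star, hs, hp, F.p_mul_range]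
  sum_range v h hn := hφ <| by
    rw [hp, F.sum_range v h hn, map_sum]
    simp only [map_mul, map_star, hs]

end CuntzKriegerFamily

/-- A C⋆-algebra together with a Cuntz-Krieger `G`-family in it. The universe is large enough to
contain, up to isomorphism, every C⋆-algebra that is generated by a Cuntz-Krieger `G`-family. -/
structure CuntzKriegerPair (G : DirectedGraph V E) : Type (max u v + 1) where
  /-- the C⋆-algebra -/
  carrier : Type (max u v)
  [inst : NonUnitalCStarAlgebra carrier]
  /-- the family -/
  family : CuntzKriegerFamily G carrier

attribute [instance] CuntzKriegerPair.inst

/-- The product of all C⋆-algebras with a Cuntz-Krieger `G`-family: bounded tuples, sup norm. -/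
abbrev UniversalProduct (G : DirectedGraph V E) : Type (max u v + 1) :=
  lp (fun i : CuntzKriegerPair G => i.carrier) ∞

/-- Evaluation of tuples at one pair. -/
noncomputable def UniversalProduct.eval (G : DirectedGraph V E) (i : CuntzKriegerPair G) :
    UniversalProduct G →⋆ₙₐ[ℂ] i.carrier where
  toFun f := f i
  map_smul' _ _ := rfl
  map_zero' := rfl
  map_add' _ _ := rfl
  map_mul' _ _ := rfl
  map_star' _ := rfl

/-- The Cuntz-Krieger family of all tuples `(P_v)` and `(S_e)`. -/
noncomputable def UniversalProduct.family (G : DirectedGraph V E) :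
    CuntzKriegerFamily G (UniversalProduct G) where
  p v := ⟨fun i => i.family.p v, memℓp_infty ⟨1, by
    rintro _ ⟨i, rfl⟩; exact i.family.norm_p_le v⟩⟩
  s e := ⟨fun i => i.family.s e, memℓp_infty ⟨1, by
    rintro _ ⟨i, rfl⟩; exact i.family.norm_s_le e⟩⟩
  isStarProjection_p v :=
    { isIdempotentElem := by
        ext i; exact (i.family.isStarProjection_p v).isIdempotentElem
      isSelfAdjoint := by
        ext i; exact (i.family.isStarProjection_p v).isSelfAdjoint }
  p_mul_p v v' h := by ext i; exact i.family.p_mul_p v v' h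
  partialIsometry_s e := by ext i; exact i.family.partialIsometry_s e
  range_mul_range e f h := by ext i; exact i.family.range_mul_range e f h
  star_s_mul_s e := by ext i; exact i.family.star_s_mul_s e
  p_mul_range e := by ext i; exact i.family.p_mul_range e
  sum_range v h hn := by
    ext i
    change i.family.p v = UniversalProduct.eval G i _
    rw [map_sum]
    exact i.family.sum_range v h hn

/-- The closed ⋆-subalgebra generated by a Cuntz-Krieger family. -/
def CuntzKriegerFamily.generated {G : DirectedGraph V E} {A : Type w} [NonUnitalCStarAlgebra A]
    (F : CuntzKriegerFamily G A) : NonUnitalStarSubalgebra ℂ A :=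
  (NonUnitalStarAlgebra.adjoin ℂ (Set.range F.p ∪ Set.range F.s)).topologicalClosure

instance {G : DirectedGraph V E} {A : Type w} [NonUnitalCStarAlgebra A]
    (F : CuntzKriegerFamily G A) : IsClosed (F.generated : Set A) :=
  NonUnitalStarSubalgebra.isClosed_topologicalClosure _

lemma CuntzKriegerFamily.p_mem_generated {G : DirectedGraph V E} {A : Type w}
    [NonUnitalCStarAlgebra A] (F : CuntzKriegerFamily G A) (v : V) : F.p v ∈ F.generated :=
  NonUnitalStarSubalgebra.le_topologicalClosure _
    (NonUnitalStarAlgebra.subset_adjoin ℂ _ (Or.inl ⟨v, rfl⟩))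

lemma CuntzKriegerFamily.s_mem_generated {G : DirectedGraph V E} {A : Type w}
    [NonUnitalCStarAlgebra A] (F : CuntzKriegerFamily G A) (e : E) : F.s e ∈ F.generated :=
  NonUnitalStarSubalgebra.le_topologicalClosure _
    (NonUnitalStarAlgebra.subset_adjoin ℂ _ (Or.inr ⟨e, rfl⟩))

/-- The graph C⋆-algebra `C⋆(G)`: the C⋆-algebra generated by the universal Cuntz-Krieger family,
realized in the product of all C⋆-algebras with a Cuntz-Krieger `G`-family. It is generated by
its canonical family (`CStar.generated_family`) and it has the universal property
(`CStar.universal`), which characterize it up to isomorphism. -/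
def CStar (G : DirectedGraph V E) : Type (max u v + 1) :=
  (UniversalProduct.family G).generated

noncomputable instance (G : DirectedGraph V E) : NonUnitalCStarAlgebra G.CStar :=
  inferInstanceAs (NonUnitalCStarAlgebra (UniversalProduct.family G).generated)

namespace CStar

/-- The inclusion of `C⋆(G)` into the product. -/
noncomputable def incl (G : DirectedGraph V E) : G.CStar →⋆ₙₐ[ℂ] UniversalProduct G :=
  NonUnitalStarSubalgebraClass.subtype (UniversalProduct.family G).generated

lemma incl_injective (G : DirectedGraph V E) : Function.Injective (incl G) :=
  Subtype.val_injective

/-- The canonical Cuntz-Krieger family `{p_v, s_e}` in `C⋆(G)`. -/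
noncomputable def family (G : DirectedGraph V E) : CuntzKriegerFamily G G.CStar :=
  (UniversalProduct.family G).comap (incl G) (incl_injective G)
    (fun v => ⟨_, (UniversalProduct.family G).p_mem_generated v⟩)
    (fun e => ⟨_, (UniversalProduct.family G).s_mem_generated e⟩)
    (fun _ => rfl) (fun _ => rfl)

/-- `C⋆(G)` is generated by its canonical family. -/
theorem generated_family (G : DirectedGraph V E) : (family G).generated = ⊤ := by
  refine SetLike.ext fun a => ⟨fun _ => trivial, fun _ => ?_⟩
  set X : Set G.CStar := Set.range (family G).p ∪ Set.range (family G).s with hX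
  have himg : incl G '' X =
      Set.range (UniversalProduct.family G).p ∪ Set.range (UniversalProduct.family G).s := by
    rw [hX, Set.image_union, ← Set.range_comp, ← Set.range_comp]
    rfl
  have ha : incl G a ∈ closure (incl G '' (NonUnitalStarAlgebra.adjoin ℂ X : Set G.CStar)) := by
    have h1 : (NonUnitalStarAlgebra.adjoin ℂ X).map (incl G) =
        NonUnitalStarAlgebra.adjoin ℂ (incl G '' X) := NonUnitalStarAlgHom.map_adjoin (incl G) X
    have h2 : incl G '' (NonUnitalStarAlgebra.adjoin ℂ X : Set G.CStar) =
        (NonUnitalStarAlgebra.adjoin ℂ (incl G '' X) : Set (UniversalProduct G)) := by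
      rw [← h1]; rfl
    rw [h2, himg]
    exact a.2
  have hind : Topology.IsInducing (incl G) := Topology.IsInducing.subtypeVal
  change a ∈ closure (NonUnitalStarAlgebra.adjoin ℂ X : Set G.CStar)
  rw [hind.closure_eq_preimage_closure_image]
  exact ha

/-- A closed ⋆-subalgebra generated by a Cuntz-Krieger `G`-family is not too large. -/
lemma small_generated {G : DirectedGraph V E} {A : Type w} [NonUnitalCStarAlgebra A]
    (F : CuntzKriegerFamily G A) : Small.{max u v} F.generated := by
  have hsX : Small.{max u v} (Set.range F.p ∪ Set.range F.s : Set A) := by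
    have h1 : Small.{max u v} (Set.range F.p) :=
      small_of_surjective (f := fun v : ULift.{max u v} V => (⟨F.p v.down, v.down, rfl⟩ :
        Set.range F.p)) (by rintro ⟨_, v, rfl⟩; exact ⟨⟨v⟩, rfl⟩)
    have h2 : Small.{max u v} (Set.range F.s) :=
      small_of_surjective (f := fun e : ULift.{max u v} E => (⟨F.s e.down, e.down, rfl⟩ :
        Set.range F.s)) (by rintro ⟨_, e, rfl⟩; exact ⟨⟨e⟩, rfl⟩)
    exact small_union _ _
  set X : Set A := Set.range F.p ∪ Set.range F.s
  have hsY : Small.{max u v} (X ∪ star X : Set A) := by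
    have : Small.{max u v} (star X : Set A) := by
      rw [← Set.image_star]; infer_instance
    exact small_union _ _
  set Y : Set A := X ∪ star X
  let g : Shrink.{max u v} Y → Unitization ℂ A := fun y => ((equivShrink Y).symm y : A)
  let T : Subalgebra ℂ (Unitization ℂ A) := (FreeAlgebra.lift ℂ g).range
  have hsT : Small.{max u v} T :=
    small_of_surjective (f := (FreeAlgebra.lift ℂ g).rangeRestrict)
      (AlgHom.rangeRestrict_surjective _)
  have hle : ∀ a ∈ NonUnitalStarAlgebra.adjoin ℂ X, (a : Unitization ℂ A) ∈ T := by
    intro a ha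
    have ha' : a ∈ NonUnitalAlgebra.adjoin ℂ Y := ha
    induction ha' using NonUnitalAlgebra.adjoin_induction with
    | mem y hy => exact ⟨FreeAlgebra.ι ℂ (equivShrink Y ⟨y, hy⟩), by simp [g]⟩
    | add y z _ _ h1 h2 => rw [Unitization.inr_add]; exact add_mem (h1 ‹_›) (h2 ‹_›)
    | zero => rw [Unitization.inr_zero]; exact zero_mem _
    | mul y z _ _ h1 h2 => rw [Unitization.inr_mul]; exact mul_mem (h1 ‹_›) (h2 ‹_›)
    | smul c y _ h => rw [Unitization.inr_smul]; exact T.smul_mem (h ‹_›) c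
  have hsD : Small.{max u v} (NonUnitalStarAlgebra.adjoin ℂ X) :=
    small_of_injective (f := fun a : NonUnitalStarAlgebra.adjoin ℂ X =>
      (⟨((a : A) : Unitization ℂ A), hle a a.2⟩ : T))
      fun a b h => Subtype.ext (Unitization.inr_injective (congrArg Subtype.val h))
  have hclos : ∀ b : F.generated, ∃ f : ℕ → NonUnitalStarAlgebra.adjoin ℂ X,
      Filter.Tendsto (fun n => (f n : A)) Filter.atTop (nhds (b : A)) := by
    intro b
    obtain ⟨f, hf, hb⟩ := mem_closure_iff_seq_limit.1 b.2
    exact ⟨fun n => ⟨f n, hf n⟩, hb⟩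
  choose f hf using hclos
  exact small_of_injective (f := f) fun b c h =>
    Subtype.ext (tendsto_nhds_unique (hf b) (h ▸ hf c))

/-- A C⋆-algebra structure can be transported along a bijection of sets. -/
lemma exists_model {D : Type w} [NonUnitalCStarAlgebra D] {D' : Type x} (e : D' ≃ D) :
    ∃ (_ : NonUnitalCStarAlgebra D') (φ : D' →⋆ₙₐ[ℂ] D), Function.Bijective φ := by
  let r : NonUnitalRing D' := e.nonUnitalRing
  let m : Module ℂ D' := e.module ℂ
  let φ : D' →ₙ+* D :=
    { toFun := e
      map_mul' := fun a b => e.apply_symm_apply _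
      map_zero' := e.apply_symm_apply _
      map_add' := fun a b => e.apply_symm_apply _ }
  let nr : NonUnitalNormedRing D' :=
    NonUnitalNormedRing.induced D' D φ e.injective
  have hnorm : ∀ a, ‖a‖ = ‖e a‖ := fun _ => rfl
  have hmul : ∀ a b, e (a * b) = e a * e b := map_mul φ
  have hadd : ∀ a b, e (a + b) = e a + e b := map_add φ
  have hsmul : ∀ (c : ℂ) a, e (c • a) = c • e a := fun _ _ => e.apply_symm_apply _
  let st : StarRing D' :=
    { star := fun a => e.symm (star (e a))
      star_involutive := fun a => e.injective (by simp)
      star_mul := fun a b => e.injective (by simp [hmul])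
      star_add := fun a b => e.injective (by simp [hadd]) }
  have hstar : ∀ a, e (star a) = star (e a) := fun _ => e.apply_symm_apply _
  have hiso : Isometry e := AddMonoidHomClass.isometry_of_norm φ fun _ => rfl
  let ns : NormedSpace ℂ D' :=
    { norm_smul_le := fun c a => by
        change ‖e (c • a)‖ ≤ ‖c‖ * ‖e a‖
        rw [hsmul, norm_smul] }
  have : CompleteSpace D' :=
    (hiso.isUniformInducing.completeSpace_congr e.surjective).2 inferInstance
  have : CStarRing D' :=
    ⟨fun a => by rw [hnorm, hnorm, hmul, hstar, CStarRing.norm_star_mul_self]⟩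
  have : IsScalarTower ℂ D' D' :=
    ⟨fun c a b => e.injective (by simp [hmul, hsmul, smul_mul_assoc])⟩
  have : SMulCommClass ℂ D' D' :=
    ⟨fun c a b => e.injective (by simp [hmul, hsmul, mul_smul_comm])⟩
  have : StarModule ℂ D' :=
    ⟨fun c a => e.injective (by simp [hstar, hsmul])⟩
  let cs : NonUnitalCStarAlgebra D' :=
    { nr, st, ns, ‹CompleteSpace D'›, ‹CStarRing D'›, ‹IsScalarTower ℂ D' D'›,
      ‹SMulCommClass ℂ D' D'›, ‹StarModule ℂ D'› with }
  exact ⟨cs,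
    { toFun := e
      map_smul' := hsmul
      map_zero' := map_zero φ
      map_add' := hadd
      map_mul' := hmul
      map_star' := hstar }, e.bijective⟩

/-- The universal property: every Cuntz-Krieger `G`-family in a C⋆-algebra, in whatever universe,
is the image of the canonical family of `C⋆(G)` under exactly one ⋆-homomorphism. -/
theorem universal (G : DirectedGraph V E) {A : Type w} [NonUnitalCStarAlgebra A]
    (F : CuntzKriegerFamily G A) :
    ∃! φ : G.CStar →⋆ₙₐ[ℂ] A, (∀ v, φ ((family G).p v) = F.p v) ∧
      ∀ e, φ ((family G).s e) = F.s e := by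
  have := small_generated F
  obtain ⟨D, ⟨e⟩⟩ := Small.equiv_small.{max u v} (α := F.generated)
  obtain ⟨_, φ, hφ⟩ := exists_model e.symm
  let ι : F.generated →⋆ₙₐ[ℂ] A := NonUnitalStarSubalgebraClass.subtype F.generated
  let ψ : D →⋆ₙₐ[ℂ] A := ι.comp φ
  have hψ : Function.Injective ψ := Subtype.val_injective.comp hφ.1
  choose p hp using fun v => hφ.2 ⟨F.p v, F.p_mem_generated v⟩
  choose s hs using fun e => hφ.2 ⟨F.s e, F.s_mem_generated e⟩
  let F' : CuntzKriegerFamily G D := F.comap ψ hψ p s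
    (fun v => congrArg Subtype.val (hp v)) (fun e => congrArg Subtype.val (hs e))
  refine ⟨ψ.comp ((UniversalProduct.eval G ⟨D, F'⟩).comp (incl G)),
    ⟨fun v => congrArg Subtype.val (hp v), fun e => congrArg Subtype.val (hs e)⟩, ?_⟩
  set χ := ψ.comp ((UniversalProduct.eval G ⟨D, F'⟩).comp (incl G)) with hχ
  have hχp : ∀ v, χ ((family G).p v) = F.p v := fun v => congrArg Subtype.val (hp v)
  have hχs : ∀ e, χ ((family G).s e) = F.s e := fun e => congrArg Subtype.val (hs e)
  rintro θ ⟨hθp, hθs⟩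
  have hθc : Continuous θ :=
    AddMonoidHomClass.continuous_of_bound θ 1 fun a => by
      simpa using NonUnitalStarAlgHom.norm_apply_le θ a
  have hχc : Continuous χ :=
    AddMonoidHomClass.continuous_of_bound χ 1 fun a => by
      simpa using NonUnitalStarAlgHom.norm_apply_le χ a
  have hcl : IsClosed {a : G.CStar | θ a = χ a} := isClosed_eq hθc hχc
  have hsub : (NonUnitalStarAlgebra.adjoin ℂ
      (Set.range (family G).p ∪ Set.range (family G).s) : Set G.CStar) ⊆ {a | θ a = χ a} := by
    intro a ha
    induction ha using NonUnitalStarAlgebra.adjoin_induction with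
    | mem y hy =>
      rcases hy with ⟨v, rfl⟩ | ⟨e, rfl⟩
      · exact (hθp v).trans (hχp v).symm
      · exact (hθs e).trans (hχs e).symm
    | add y z _ _ h1 h2 =>
      change θ (y + z) = χ (y + z)
      rw [map_add, map_add, show θ y = χ y from h1, show θ z = χ z from h2]
    | zero => exact (map_zero θ).trans (map_zero χ).symm
    | mul y z _ _ h1 h2 =>
      change θ (y * z) = χ (y * z)
      rw [map_mul, map_mul, show θ y = χ y from h1, show θ z = χ z from h2]
    | smul c y _ h =>
      change θ (c • y) = χ (c • y)
      rw [map_smul, map_smul, show θ y = χ y from h]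
    | star y _ h =>
      change θ (star y) = χ (star y)
      rw [map_star, map_star, show θ y = χ y from h]
  refine NonUnitalStarAlgHom.ext fun a => closure_minimal hsub hcl ?_
  have ha : a ∈ (family G).generated := by rw [generated_family]; trivial
  exact ha

end CStar

end DirectedGraph

/-! ### Representations of C⋆-algebras on Hilbert spaces -/

section Representations

variable {A : Type w} [NonUnitalCStarAlgebra A]
  {H : Type x} [NormedAddCommGroup H] [InnerProductSpace ℂ H] [CompleteSpace H]

/-- `π(A)S`, the closed linear span of `{π(a)h : a ∈ A, h ∈ S}`. -/
def repSpan (π : A →⋆ₙₐ[ℂ] (H →L[ℂ] H)) (S : Set H) : Submodule ℂ H :=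
  (Submodule.span ℂ {y | ∃ a : A, ∃ h ∈ S, π a h = y}).topologicalClosure

/-- The representation is countably generated: `π(A)S = H` for a countable `S ⊆ H`. -/
def IsCountablyGeneratedRep (π : A →⋆ₙₐ[ℂ] (H →L[ℂ] H)) : Prop :=
  ∃ S : Set H, S.Countable ∧ repSpan π S = ⊤

/-- The representation is cyclic: `π(A)h = H` for some `h ∈ H`. -/
def IsCyclicRep (π : A →⋆ₙₐ[ℂ] (H →L[ℂ] H)) : Prop :=
  ∃ h : H, repSpan π {h} = ⊤

/-- The representation is irreducible: the only closed invariant subspaces are `0` and `H`. -/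
def IsIrreducibleRep (π : A →⋆ₙₐ[ℂ] (H →L[ℂ] H)) : Prop :=
  ∀ K : Submodule ℂ H, IsClosed (K : Set H) → (∀ a : A, ∀ k ∈ K, π a k ∈ K) → K = ⊥ ∨ K = ⊤

end Representations

/-- A C⋆-algebra is primitive if it has a faithful irreducible ⋆-representation on some Hilbert
space; the universe of the Hilbert space is a parameter. -/
def IsPrimitiveCStarAlgebra (A : Type w) [NonUnitalCStarAlgebra A] : Prop :=
  ∃ (H : Type x) (_ : NormedAddCommGroup H) (_ : InnerProductSpace ℂ H) (_ : CompleteSpace H)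
    (π : A →⋆ₙₐ[ℂ] (H →L[ℂ] H)), Function.Injective π ∧ IsIrreducibleRep π

/-!
Let `t(β, w) = s_{e₁} ⋯ s_{eₙ} p_w` for a list `β = e₁ … eₙ` of edges and a vertex `w`. For fixed `n`
these elements have pairwise orthogonal ranges, so by Bessel's inequality each vector `h` of a
representation satisfies `t(β, w)* h ≠ 0` for only countably many pairs `(β, w)`
(`countable_setOf_adjoint_apply_ne_zero`). If a countable set `S` generates the representation,
then the set `X` of the vertices `w` with `t(β, w)* h ≠ 0` for some `β` and some `h ∈ S` is therefore
countable. Let `Y` be the set of the vertices from which `X` can be reached. The vectors killed by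
`t(β, w)*` for all `β` and all `w ∉ Y` form a closed subspace that contains `S` and is invariant,
because `Y` contains the source of an edge as soon as it contains its range
(`generated_apply_mem_pathNull`). So it is the whole space, and `p_w` acts as zero for `w ∉ Y`. In a
faithful representation this forces `Y` to contain every vertex, provided that all `p_w` are
nonzero in `C⋆(G)`.

The last point needs one family whose vertex projections do not vanish. It lives on `ℓ²(V × K)`
with `K = E ⊕ ℕ`: the projection `p_v` is onto `ℓ²({v} × K)`, and the set `K` is infinite and at least
as large as `E`, so for every `v` that is not a sink there is a bijection `s⁻¹(v) × K ≃ K`, which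
lets `s_e` map `ℓ²({r(e)} × K)` onto a piece of `ℓ²({s(e)} × K)`, these pieces filling the latter
(`exists_cuntzKriegerFamily_p_ne_zero`). A cyclic representation is countably generated, and a
nonzero irreducible one is cyclic.
-/

/-! ### Operators with orthogonal ranges -/

/-- A Bessel-type bound: the vectors `Tᵢ Tᵢ* h` are pairwise orthogonal and
`⟪Tᵢ Tᵢ* h, h⟫ = ‖Tᵢ* h‖²`. -/
lemma countable_setOf_adjoint_apply_ne_zero {H : Type x} [NormedAddCommGroup H]
    [InnerProductSpace ℂ H] [CompleteSpace H] {ι : Type w} (T : ι → H →L[ℂ] H)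
    (hT : ∀ i j, i ≠ j → star (T i) * T j = 0) (h : H) :
    {i | star (T i) h ≠ 0}.Countable := by
  have hin : ∀ i (y z : H), inner ℂ (T i y) z = inner ℂ y (star (T i) z) := fun i y z =>
    (ContinuousLinearMap.adjoint_inner_right (T i) y z).symm
  let J := {i // star (T i) h ≠ 0}
  let y : J → H := fun i => T i (star (T i) h)
  have hyh : ∀ i : J, inner ℂ (y i) h ≠ 0 := fun i => by
    change inner ℂ (T i (star (T i) h)) h ≠ 0
    rw [hin]
    exact inner_self_ne_zero.2 i.2
  have hy0 : ∀ i, y i ≠ 0 := fun i h0 => hyh i (by rw [h0, inner_zero_left])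
  have horth : Orthonormal ℂ fun i => ((‖y i‖ : ℂ)⁻¹) • y i := by
    refine ⟨fun i => norm_smul_inv_norm (hy0 i), fun i j hij => ?_⟩
    have h0 : star (T i) (T j (star (T j) h)) = 0 :=
      DFunLike.congr_fun (hT i j fun h => hij (Subtype.ext h)) (star (T j) h)
    have : inner ℂ (y i) (y j) = 0 := by
      change inner ℂ (T i (star (T i) h)) (T j (star (T j) h)) = 0
      rw [hin, h0, inner_zero_right]
    beta_reduce
    rw [inner_smul_left, inner_smul_right, this, mul_zero, mul_zero]
  have hs := (horth.inner_products_summable (x := h)).countable_support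
  have huniv : Function.support (fun i : J => ‖inner ℂ (((‖y i‖ : ℂ)⁻¹) • y i) h‖ ^ 2) =
      Set.univ := by
    refine Set.eq_univ_of_forall fun i => ?_
    rw [Function.mem_support, inner_smul_left]
    refine pow_ne_zero _ (norm_ne_zero_iff.2 (mul_ne_zero ?_ (hyh i)))
    simpa using hy0 i
  rw [huniv] at hs
  exact Set.countable_univ_iff.1 hs

/-! ### Path elements of a Cuntz-Krieger family -/

namespace DirectedGraph

variable {V : Type u} {E : Type v} {G : DirectedGraph V E}

lemma reaches_refl (G : DirectedGraph V E) (v : V) : G.Reaches v v := ⟨[], rfl⟩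

lemma Reaches.cons {e : E} {w : V} (h : G.Reaches (G.rng e) w) : G.Reaches (G.src e) w :=
  let ⟨α, hα⟩ := h
  ⟨e :: α, rfl, hα⟩

namespace CuntzKriegerFamily

variable {A : Type w} [NonUnitalCStarAlgebra A] (F : CuntzKriegerFamily G A)

lemma star_p (v : V) : star (F.p v) = F.p v := (F.isStarProjection_p v).isSelfAdjoint.star_eq

lemma p_mul_self (v : V) : F.p v * F.p v = F.p v := (F.isStarProjection_p v).isIdempotentElem.eq

lemma s_mul_p (e : E) : F.s e * F.p (G.rng e) = F.s e := by
  rw [← F.star_s_mul_s, ← mul_assoc, F.partialIsometry_s]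

lemma p_mul_s (e : E) : F.p (G.src e) * F.s e = F.s e := by
  rw [← F.partialIsometry_s e, ← mul_assoc, F.p_mul_range]

lemma p_mul_s_of_ne {v : V} {e : E} (h : v ≠ G.src e) : F.p v * F.s e = 0 := by
  rw [← F.p_mul_s, ← mul_assoc, F.p_mul_p v _ h, zero_mul]

lemma star_s_mul_s_of_ne {e f : E} (h : e ≠ f) : star (F.s e) * F.s f = 0 := by
  have he : star (F.s e) * (F.s e * star (F.s e)) = star (F.s e) := by
    have := congrArg star (F.partialIsometry_s e)
    simpa [mul_assoc] using this
  rw [← he, ← F.partialIsometry_s f, mul_assoc, ← mul_assoc (F.s e * star (F.s e)),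
    F.range_mul_range e f h, zero_mul, mul_zero]

/-- The element `s_{e₁} ⋯ s_{eₙ} p_w` for a list `e₁ … eₙ` of edges. The list need not be a path
with range `w`; if it is not, then the element is zero. -/
def pathElt : List E → V → A
  | [], w => F.p w
  | e :: β, w => F.s e * pathElt β w

lemma p_mul_pathElt (v : V) (β : List E) (w : V) :
    F.p v * F.pathElt β w = F.pathElt β w ∨ F.p v * F.pathElt β w = 0 := by
  cases β with
  | nil =>
    by_cases h : v = w
    · subst h; exact Or.inl (F.p_mul_self v)
    · exact Or.inr (F.p_mul_p v w h)
  | cons e β =>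
    simp only [pathElt, ← mul_assoc]
    by_cases h : v = G.src e
    · subst h; rw [F.p_mul_s]; exact Or.inl rfl
    · rw [F.p_mul_s_of_ne h, zero_mul]; exact Or.inr rfl

/-- Path elements of the same length have orthogonal ranges. -/
lemma star_pathElt_mul_pathElt {w w' : V} : ∀ {β γ : List E}, β.length = γ.length →
    (β, w) ≠ (γ, w') → star (F.pathElt β w) * F.pathElt γ w' = 0
  | [], [], _, h => by
    simp only [pathElt, star_p]
    exact F.p_mul_p w w' fun h' => h (by rw [h'])
  | e :: β, f :: γ, hl, h => by
    simp only [pathElt, star_mul]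
    rw [mul_assoc, ← mul_assoc (star (F.s e))]
    by_cases hef : e = f
    · subst hef
      have ih : star (F.pathElt β w) * F.pathElt γ w' = 0 :=
        star_pathElt_mul_pathElt (Nat.succ.inj hl) fun h' => h (by
          obtain ⟨rfl, rfl⟩ := Prod.mk.inj h'; rfl)
      rw [F.star_s_mul_s]
      rcases F.p_mul_pathElt (G.rng e) γ w' with h1 | h1 <;> simp [h1, ih]
    · rw [F.star_s_mul_s_of_ne hef, zero_mul, mul_zero]

/-! ### An invariant subspace attached to a set of vertices -/

section Rep

variable {H : Type x} [NormedAddCommGroup H] [InnerProductSpace ℂ H] [CompleteSpace H]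
  (π : A →⋆ₙₐ[ℂ] (H →L[ℂ] H))

/-- The vectors annihilated by the adjoints of all path elements that end outside `Y`. -/
def pathNull (Y : Set V) : Submodule ℂ H where
  carrier := {k | ∀ β, ∀ w ∉ Y, π (star (F.pathElt β w)) k = 0}
  add_mem' ha hb β w hw := by rw [map_add, ha β w hw, hb β w hw, add_zero]
  zero_mem' _ _ _ := map_zero _
  smul_mem' c k hk β w hw := by rw [map_smul, hk β w hw, smul_zero]

variable {F π} in
lemma mem_pathNull {Y : Set V} {k : H} :
    k ∈ F.pathNull π Y ↔ ∀ β, ∀ w ∉ Y, π (star (F.pathElt β w)) k = 0 := Iff.rfl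

lemma isClosed_pathNull (Y : Set V) : IsClosed (F.pathNull π Y : Set H) := by
  have : (F.pathNull π Y : Set H) = ⋂ β, ⋂ w, ⋂ _ : w ∉ Y,
      {k | π (star (F.pathElt β w)) k = 0} := by
    ext k; simp [mem_pathNull]
  rw [this]
  exact isClosed_iInter fun β => isClosed_iInter fun w => isClosed_iInter fun _ =>
    isClosed_eq (ContinuousLinearMap.continuous _) continuous_const

lemma p_apply_mem_pathNull {Y : Set V} (u : V) {k : H} (hk : k ∈ F.pathNull π Y) :
    π (F.p u) k ∈ F.pathNull π Y := fun β w hw => by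
  rw [← mul_apply_eq_comp, ← map_mul, ← F.star_p u, ← star_mul]
  rcases F.p_mul_pathElt u β w with h | h <;> rw [h]
  · exact hk β w hw
  · simp

lemma star_s_apply_mem_pathNull {Y : Set V} (e : E) {k : H} (hk : k ∈ F.pathNull π Y) :
    π (star (F.s e)) k ∈ F.pathNull π Y := fun β w hw => by
  rw [← mul_apply_eq_comp, ← map_mul, ← star_mul]
  exact hk (e :: β) w hw

lemma s_apply_mem_pathNull {Y : Set V} (hY : ∀ e, G.rng e ∈ Y → G.src e ∈ Y) (e : E) {k : H}
    (hk : k ∈ F.pathNull π Y) : π (F.s e) k ∈ F.pathNull π Y := fun β w hw => by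
  rw [← mul_apply_eq_comp, ← map_mul]
  cases β with
  | nil =>
    simp only [pathElt, star_p]
    by_cases h : w = G.src e
    · subst h
      have h0 : π (F.p (G.rng e)) k = 0 := by
        rw [← F.star_p]; exact hk [] (G.rng e) fun h => hw (hY e h)
      rw [F.p_mul_s, ← F.s_mul_p, map_mul, mul_apply_eq_comp, h0, map_zero]
    · rw [F.p_mul_s_of_ne h]; simp
  | cons f γ =>
    simp only [pathElt, star_mul]
    rw [mul_assoc]
    by_cases h : f = e
    · subst h
      rw [F.star_s_mul_s, ← F.star_p, ← star_mul]
      rcases F.p_mul_pathElt (G.rng f) γ w with h | h <;> rw [h]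
      · exact hk γ w hw
      · simp
    · rw [F.star_s_mul_s_of_ne h]; simp

lemma continuous_rep_apply (k : H) : Continuous fun a => π a k := by
  have hπ : Continuous π := AddMonoidHomClass.continuous_of_bound π 1 fun a => by
    simpa using NonUnitalStarAlgHom.norm_apply_le π a
  exact (ContinuousLinearMap.apply ℂ H k).continuous.comp hπ

/-- If every edge with range in `Y` has its source in `Y`, then `pathNull` is invariant under the
C⋆-algebra generated by the family. -/
lemma generated_apply_mem_pathNull {Y : Set V} (hY : ∀ e, G.rng e ∈ Y → G.src e ∈ Y) {a : A}
    (ha : a ∈ F.generated) {k : H} (hk : k ∈ F.pathNull π Y) : π a k ∈ F.pathNull π Y := by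
  -- Invariance under `a` alone does not pass to `star a`, so the induction carries both.
  have hsub : ∀ a ∈ NonUnitalStarAlgebra.adjoin ℂ (Set.range F.p ∪ Set.range F.s),
      (∀ k ∈ F.pathNull π Y, π a k ∈ F.pathNull π Y) ∧
      ∀ k ∈ F.pathNull π Y, π (star a) k ∈ F.pathNull π Y := by
    intro a ha
    induction ha using NonUnitalStarAlgebra.adjoin_induction with
    | mem y hy =>
      rcases hy with ⟨v, rfl⟩ | ⟨e, rfl⟩
      · rw [F.star_p]
        exact ⟨fun k => F.p_apply_mem_pathNull π v, fun k => F.p_apply_mem_pathNull π v⟩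
      · exact ⟨fun k => F.s_apply_mem_pathNull π hY e, fun k => F.star_s_apply_mem_pathNull π e⟩
    | add y z _ _ h1 h2 =>
      simp only [star_add, map_add, add_apply]
      exact ⟨fun k hk => add_mem (h1.1 k hk) (h2.1 k hk),
        fun k hk => add_mem (h1.2 k hk) (h2.2 k hk)⟩
    | zero => simp
    | mul y z _ _ h1 h2 =>
      simp only [star_mul, map_mul, mul_apply_eq_comp]
      exact ⟨fun k hk => h1.1 _ (h2.1 k hk), fun k hk => h2.2 _ (h1.2 k hk)⟩
    | smul c y _ h =>
      simp only [star_smul, map_smul, smul_apply]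
      exact ⟨fun k hk => Submodule.smul_mem _ _ (h.1 k hk),
        fun k hk => Submodule.smul_mem _ _ (h.2 k hk)⟩
    | star y _ h => rw [star_star]; exact ⟨h.2, h.1⟩
  exact closure_minimal (s := (NonUnitalStarAlgebra.adjoin ℂ
      (Set.range F.p ∪ Set.range F.s) : Set A)) (fun a ha => (hsub a ha).1 k hk)
    ((F.isClosed_pathNull π Y).preimage (continuous_rep_apply π k)) ha

/-- The vertices `w` such that the adjoint of some path element ending at `w` does not kill every
vector of `S`. -/
def detectedVertices (S : Set H) : Set V :=
  {w | ∃ h ∈ S, ∃ β, π (star (F.pathElt β w)) h ≠ 0}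

lemma countable_detectedVertices {S : Set H} (hS : S.Countable) :
    (F.detectedVertices π S).Countable := by
  have hn : ∀ (h : H) (n : ℕ), {i : {β : List E // β.length = n} × V |
      π (star (F.pathElt i.1 i.2)) h ≠ 0}.Countable := fun h n => by
    have := countable_setOf_adjoint_apply_ne_zero
      (fun i : {β : List E // β.length = n} × V => π (F.pathElt i.1 i.2)) (fun i j hij => by
        rw [← map_star, ← map_mul, F.star_pathElt_mul_pathElt (i.1.2.trans j.1.2.symm), map_zero]
        intro h
        obtain ⟨h1, h2⟩ := Prod.ext_iff.1 h
        exact hij (Prod.ext (Subtype.ext h1) h2)) h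
    simpa only [← map_star] using this
  refine (hS.biUnion fun h _ => Set.countable_iUnion fun n =>
    (hn h n).image Prod.snd).mono ?_
  rintro w ⟨h, hh, β, hβ⟩
  exact Set.mem_biUnion hh (Set.mem_iUnion.2 ⟨β.length, (⟨β, rfl⟩, w), hβ, rfl⟩)

/-- A faithful countably generated representation of a C⋆-algebra generated by a Cuntz-Krieger
family with nonzero vertex projections forces the Countable Separation Property. -/
theorem countableSeparationProperty_of_isCountablyGeneratedRep (hF : F.generated = ⊤)
    (hp : ∀ v, F.p v ≠ 0) (hπ : Function.Injective π) (hc : IsCountablyGeneratedRep π) :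
    G.CountableSeparationProperty := by
  obtain ⟨S, hS, hspan⟩ := hc
  set X := F.detectedVertices π S with hX
  refine ⟨X, F.countable_detectedVertices π hS, ?_⟩
  set Y : Set V := ⋃ x ∈ X, G.U x with hYdef
  have hY : ∀ e, G.rng e ∈ Y → G.src e ∈ Y := fun e he => by
    obtain ⟨w, hw, h⟩ := Set.mem_iUnion₂.1 he
    exact Set.mem_biUnion hw (Reaches.cons h)
  have hSN : ∀ h ∈ S, h ∈ F.pathNull π Y := fun h hh β w hw => by
    by_contra h0
    exact hw (Set.mem_biUnion (x := w) ⟨h, hh, β, h0⟩ (G.reaches_refl w))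
  have htop : F.pathNull π Y = ⊤ := by
    rw [eq_top_iff, ← hspan]
    refine Submodule.topologicalClosure_minimal _ (Submodule.span_le.2 ?_)
      (F.isClosed_pathNull π Y)
    rintro _ ⟨a, h, hh, rfl⟩
    exact F.generated_apply_mem_pathNull π hY (hF ▸ trivial) (hSN h hh)
  refine Set.eq_univ_of_forall fun v => ?_
  by_contra hv
  refine hp v (hπ ?_)
  rw [map_zero]
  ext k
  have hk : k ∈ F.pathNull π Y := htop ▸ trivial
  rw [← F.star_p]
  exact hk [] v hv

end Rep

end CuntzKriegerFamily

end DirectedGraph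

/-! ### Partial permutations of an orthonormal basis -/

namespace PEquiv

variable {J : Type w}

/-- Transport of a function along a partial bijection, extended by zero. -/
def extendZero (f : J ≃. J) (x : J → ℂ) (j : J) : ℂ := (f.symm j).elim 0 x

lemma sum_extendZero_le (f : J ≃. J) (x : lp (fun _ : J => ℂ) 2) (s : Finset J) :
    ∑ j ∈ s, ‖f.extendZero x j‖ ^ (2 : ℝ≥0∞).toReal ≤ ‖x‖ ^ (2 : ℝ≥0∞).toReal := by
  classical
  refine le_trans (le_of_eq ?_) (lp.sum_rpow_le_norm_rpow (by norm_num) x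
    (s.filterMap f.symm fun a b c ha hb => f.symm.inj ha hb))
  have hsome : ∀ j, ‖f.extendZero x j‖ ^ (2 : ℝ≥0∞).toReal ≠ 0 → ∃ i, f.symm j = some i := by
    intro j hj
    cases h : f.symm j with
    | none => simp [extendZero, h] at hj
    | some i => exact ⟨i, rfl⟩
  choose g hg using hsome
  refine Finset.sum_bij_ne_zero (fun j _ hj => g j hj) ?_ ?_ ?_ ?_
  · exact fun j hj h0 => (Finset.mem_filterMap _).2 ⟨j, hj, hg j h0⟩
  · intro a _ ha b _ hb h
    exact f.symm.inj (hg a ha) (h ▸ hg b hb)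
  · intro i hi h0
    obtain ⟨j, hj, h⟩ := (Finset.mem_filterMap _).1 hi
    have hj0 : ‖f.extendZero x j‖ ^ (2 : ℝ≥0∞).toReal ≠ 0 := by
      simpa [extendZero, h] using h0
    exact ⟨j, hj, hj0, Option.some.inj ((hg j hj0).symm.trans h)⟩
  · intro j hj h0
    simp [extendZero, hg j h0]

/-- The partial isometry of `ℓ²(J)` that permutes the standard basis as prescribed by a partial
bijection of `J`: it sends `δ_i` to `δ_{f i}` if `f i` is defined, and to `0` otherwise. -/
noncomputable def toCLM (f : J ≃. J) : lp (fun _ : J => ℂ) 2 →L[ℂ] lp (fun _ : J => ℂ) 2 :=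
  LinearMap.mkContinuous
    { toFun := fun x => ⟨f.extendZero x, memℓp_gen' (f.sum_extendZero_le x)⟩
      map_add' := fun x y => by
        ext j
        change f.extendZero (x + y) j = f.extendZero x j + f.extendZero y j
        cases h : f.symm j <;> simp [extendZero, h]
      map_smul' := fun c x => by
        ext j
        change f.extendZero (c • x) j = c • f.extendZero x j
        cases h : f.symm j <;> simp [extendZero, h] } 1
    fun x => by
      rw [one_mul]
      exact lp.norm_le_of_forall_sum_le (by norm_num) (norm_nonneg _) (f.sum_extendZero_le x)

lemma toCLM_apply (f : J ≃. J) (x : lp (fun _ : J => ℂ) 2) (j : J) :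
    f.toCLM x j = (f.symm j).elim 0 x := rfl

lemma toCLM_trans (f g : J ≃. J) : (f.trans g).toCLM = g.toCLM * f.toCLM := by
  ext x j
  simp only [mul_apply_eq_comp, toCLM_apply, symm_trans_rev]
  change ((g.symm j).bind f.symm).elim 0 x = _
  cases h : g.symm j <;> simp [toCLM_apply]

lemma star_toCLM (f : J ≃. J) : star f.toCLM = f.symm.toCLM := by
  rw [ContinuousLinearMap.star_eq_adjoint, eq_comm, ContinuousLinearMap.eq_adjoint_iff]
  intro x y
  rw [lp.inner_eq_tsum, lp.inner_eq_tsum]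
  simp only [toCLM_apply, symm_symm]
  have hsome : ∀ j : Function.support fun j => inner ℂ (x j) ((f.symm j).elim 0 y),
      ∃ i, f.symm j = some i := by
    rintro ⟨j, hj⟩
    cases h : f.symm j with
    | none => simp [h] at hj
    | some i => exact ⟨i, rfl⟩
  choose g hg using hsome
  refine tsum_eq_tsum_of_ne_zero_bij g ?_ ?_ ?_
  · intro a b h
    exact Subtype.ext (f.symm.inj (hg a) (h ▸ hg b))
  · intro i hi
    cases h : f i with
    | none => simp [h] at hi
    | some j =>
      have h' : f.symm j = some i := f.mem_iff_mem.2 h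
      have hj : j ∈ Function.support fun j => inner ℂ (x j) ((f.symm j).elim 0 y) := by
        simpa [h, h'] using hi
      exact ⟨⟨j, hj⟩, Option.some.inj ((hg ⟨j, hj⟩).symm.trans h')⟩
  · intro j
    have h' : f (g j) = some j.1 := f.mem_iff_mem.1 (hg j)
    simp [h', hg j]

open Classical in
/-- The coordinate projection of `ℓ²(J)` onto `ℓ²(B)`, for a subset `B` of `J`. -/
noncomputable def coordProj (B : Set J) :
    lp (fun _ : J => ℂ) 2 →L[ℂ] lp (fun _ : J => ℂ) 2 := (PEquiv.ofSet B).toCLM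

open Classical in
lemma coordProj_apply (B : Set J) (x : lp (fun _ : J => ℂ) 2) (j : J) :
    coordProj B x j = if j ∈ B then x j else 0 := by
  rw [coordProj, toCLM_apply, ofSet_symm]
  change (if j ∈ B then some j else none).elim 0 x = _
  split_ifs <;> rfl

lemma coordProj_mul (B C : Set J) : coordProj B * coordProj C = coordProj (B ∩ C) := by
  ext x j
  simp only [mul_apply_eq_comp, coordProj_apply]
  by_cases hB : j ∈ B
  · by_cases hC : j ∈ C
    · rw [if_pos hB, if_pos hC, if_pos ⟨hB, hC⟩]
    · rw [if_pos hB, if_neg hC, if_neg fun h => hC h.2]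
  · rw [if_neg hB, if_neg fun h => hB h.1]

lemma coordProj_empty : coordProj (∅ : Set J) = 0 := by
  ext x j
  simp [coordProj_apply]

lemma isStarProjection_coordProj (B : Set J) : IsStarProjection (coordProj B) where
  isIdempotentElem := by rw [IsIdempotentElem, coordProj_mul, Set.inter_self]
  isSelfAdjoint := by rw [IsSelfAdjoint, coordProj, star_toCLM, ofSet_symm]

lemma coordProj_ne_zero {B : Set J} (hB : B.Nonempty) : coordProj B ≠ 0 := fun h => by
  classical
  obtain ⟨j, hj⟩ := hB
  have := congrArg (fun T : lp (fun _ : J => ℂ) 2 →L[ℂ] lp (fun _ : J => ℂ) 2 =>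
    T (lp.single 2 j 1) j) h
  simp [coordProj_apply, hj] at this

lemma star_toCLM_mul_toCLM (f : J ≃. J) :
    star f.toCLM * f.toCLM = coordProj {i | (f i).isSome} := by
  rw [star_toCLM, ← toCLM_trans, self_trans_symm, coordProj]
  congr!

lemma toCLM_mul_star_toCLM (f : J ≃. J) :
    f.toCLM * star f.toCLM = coordProj {j | (f.symm j).isSome} := by
  rw [star_toCLM, ← toCLM_trans, symm_trans_self, coordProj]
  congr!

lemma coordProj_eq_sum {ι : Type x} {B : Set J} (s : Finset ι) (C : ι → Set J)
    (hC : ∀ i ∈ s, C i ⊆ B) (h : ∀ j ∈ B, ∃! i, i ∈ s ∧ j ∈ C i) :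
    coordProj B = ∑ i ∈ s, coordProj (C i) := by
  ext x j
  simp only [sum_apply, lp.coeFn_sum, Finset.sum_apply, coordProj_apply]
  by_cases hj : j ∈ B
  · obtain ⟨i, ⟨his, hi⟩, huniq⟩ := h j hj
    rw [Finset.sum_eq_single_of_mem i his, if_pos hj, if_pos hi]
    exact fun k hk hki => if_neg fun hjk => hki (huniq k ⟨hk, hjk⟩)
  · rw [if_neg hj, Finset.sum_eq_zero]
    exact fun i hi => if_neg fun h => hj (hC i hi h)

end PEquiv

/-! ### A family with nonzero vertex projections -/

namespace DirectedGraph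

variable {V : Type u} {E : Type v} (G : DirectedGraph V E)

/-- The infinite set `E ⊕ ℕ` is at least as large as the set of edges out of any vertex, so it is
in bijection with its product with any such nonempty set. For each `v` that is not a sink, the
images of the `enc e` with source `v` partition it. -/
lemma exists_edge_encoding : ∃ enc : E → E ⊕ ℕ → E ⊕ ℕ,
    (∀ e f k l, G.src e = G.src f → enc e k = enc f l → e = f ∧ k = l) ∧
    ∀ e k, ∃ f l, G.src f = G.src e ∧ enc f l = k := by
  have key : ∀ v, (∃ e, G.src e = v) → Nonempty ({e // G.src e = v} × (E ⊕ ℕ) ≃ E ⊕ ℕ) := by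
    rintro v ⟨e, he⟩
    have : Nonempty {e // G.src e = v} := ⟨e, he⟩
    have hle : Cardinal.mk {e // G.src e = v} ≤ Cardinal.mk (E ⊕ ℕ) :=
      Cardinal.mk_le_of_injective (f := fun e => Sum.inl e.1) fun a b h =>
        Subtype.ext (Sum.inl.inj h)
    refine Cardinal.eq.1 ?_
    rw [← Cardinal.mul_def]
    exact Cardinal.mul_eq_right (Cardinal.aleph0_le_mk _) hle (Cardinal.mk_ne_zero _)
  let ψ v h := (key v h).some
  have hψ : ∀ {v} e (he : G.src e = v) k,
      ψ (G.src e) ⟨e, rfl⟩ (⟨e, rfl⟩, k) = ψ v ⟨e, he⟩ (⟨e, he⟩, k) := by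
    rintro _ e rfl k; rfl
  refine ⟨fun e k => ψ (G.src e) ⟨e, rfl⟩ (⟨e, rfl⟩, k), fun e f k l hef h => ?_, fun e k => ?_⟩
  · beta_reduce at h
    rw [hψ e hef k] at h
    obtain ⟨h1, h2⟩ := Prod.mk.inj ((ψ (G.src f) ⟨f, rfl⟩).injective h)
    exact ⟨congrArg Subtype.val h1, h2⟩
  · obtain ⟨⟨⟨f, hf⟩, l⟩, h⟩ := (ψ (G.src e) ⟨e, rfl⟩).surjective k
    exact ⟨f, l, hf, (hψ f hf l).trans h⟩

variable {G}

open Classical in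
/-- The partial bijection of `V × K` that maps `{r(e)} × K` into `{s(e)} × K`, acting on the second
coordinate by an injection `g`. -/
noncomputable def edgePEquiv (G : DirectedGraph V E) {K : Type w} (e : E) (g : K → K)
    (hg : g.Injective) : V × K ≃. V × K where
  toFun j := if j.1 = G.rng e then some (G.src e, g j.2) else none
  invFun j := if h : j.1 = G.src e ∧ ∃ k, g k = j.2 then some (G.rng e, h.2.choose) else none
  inv := by
    rintro ⟨v, k⟩ ⟨w, l⟩
    simp only [Option.dite_none_right_eq_some, Option.ite_none_right_eq_some,
      Option.some.injEq, Prod.mk.injEq]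
    constructor
    · rintro ⟨⟨h1, h2⟩, h3, h4⟩
      exact ⟨h3.symm, h1.symm, h4 ▸ h2.choose_spec⟩
    · rintro ⟨h1, h2, h3⟩
      have h : ∃ k, g k = l := ⟨k, h3⟩
      exact ⟨⟨h2.symm, h⟩, h1.symm, hg (h.choose_spec.trans h3.symm)⟩

lemma setOf_isSome_edgePEquiv {K : Type w} (e : E) (g : K → K) (hg : g.Injective) :
    {j | (G.edgePEquiv e g hg j).isSome} = {j | j.1 = G.rng e} := by
  classical
  ext j
  change (if j.1 = G.rng e then some (G.src e, g j.2) else none).isSome ↔ _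
  split_ifs with h <;> simp [h]

lemma setOf_isSome_edgePEquiv_symm {K : Type w} (e : E) (g : K → K) (hg : g.Injective) :
    {j | ((G.edgePEquiv e g hg).symm j).isSome} = {j | j.1 = G.src e ∧ ∃ k, g k = j.2} := by
  classical
  ext j
  change (if h : j.1 = G.src e ∧ ∃ k, g k = j.2 then
    some (G.rng e, h.2.choose) else none).isSome ↔ _
  split_ifs with h <;> simp [h]

variable (G) in
/-- Every graph has a Cuntz-Krieger family on a Hilbert space in which no vertex projection
vanishes. -/
theorem exists_cuntzKriegerFamily_p_ne_zero :
    ∃ F : CuntzKriegerFamily G (lp (fun _ : V × (E ⊕ ℕ) => ℂ) 2 →L[ℂ]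
      lp (fun _ : V × (E ⊕ ℕ) => ℂ) 2), ∀ v, F.p v ≠ 0 := by
  obtain ⟨enc, hinj, hsurj⟩ := G.exists_edge_encoding
  have hi : ∀ e, (enc e).Injective := fun e k l h => (hinj e e k l rfl h).2
  let P : V → Set (V × (E ⊕ ℕ)) := fun v => {j | j.1 = v}
  let R : E → Set (V × (E ⊕ ℕ)) := fun e => {j | j.1 = G.src e ∧ ∃ k, enc e k = j.2}
  let T := fun e => (G.edgePEquiv e (enc e) (hi e)).toCLM
  have hTP : ∀ e, star (T e) * T e = PEquiv.coordProj (P (G.rng e)) := fun e => by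
    rw [PEquiv.star_toCLM_mul_toCLM, setOf_isSome_edgePEquiv]
  have hTR : ∀ e, T e * star (T e) = PEquiv.coordProj (R e) := fun e => by
    rw [PEquiv.toCLM_mul_star_toCLM, setOf_isSome_edgePEquiv_symm]
  have hTT : ∀ e, T e * star (T e) * T e = T e := fun e => by
    rw [PEquiv.star_toCLM, ← PEquiv.toCLM_trans, ← PEquiv.toCLM_trans, ← PEquiv.trans_assoc,
      PEquiv.self_trans_symm]
    congr 1
    refine PEquiv.ext fun j => ?_
    change (if (G.edgePEquiv e (enc e) (hi e) j).isSome then some j else none).bind _ = _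
    cases h : G.edgePEquiv e (enc e) (hi e) j <;> simp [h]
  have hsub : ∀ e, R e ⊆ P (G.src e) := fun e j hj => hj.1
  have hdisj : ∀ {e f j}, j ∈ R e → j ∈ R f → e = f := by
    rintro e f j ⟨h1, k, hk⟩ ⟨h2, l, hl⟩
    exact (hinj e f k l (h1.symm.trans h2) (hk.trans hl.symm)).1
  refine ⟨
    { p := fun v => PEquiv.coordProj (P v)
      s := T
      isStarProjection_p := fun v => PEquiv.isStarProjection_coordProj _
      p_mul_p := fun v v' h => by
        have : P v ∩ P v' = ∅ := Set.eq_empty_of_forall_notMem fun j hj => h (hj.1.symm.trans hj.2)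
        rw [PEquiv.coordProj_mul, this, PEquiv.coordProj_empty]
      partialIsometry_s := hTT
      range_mul_range := fun e f h => by
        have : R e ∩ R f = ∅ := Set.eq_empty_of_forall_notMem fun j hj => h (hdisj hj.1 hj.2)
        rw [hTR, hTR, PEquiv.coordProj_mul, this, PEquiv.coordProj_empty]
      star_s_mul_s := hTP
      p_mul_range := fun e => by
        rw [hTR, PEquiv.coordProj_mul, Set.inter_eq_right.2 (hsub e)]
      sum_range := fun v h hne => by
        simp only [hTR]
        refine PEquiv.coordProj_eq_sum _ _ ?_ ?_
        · intro e he
          obtain rfl : G.src e = v := h.mem_toFinset.1 he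
          exact hsub e
        · rintro ⟨_, k⟩ rfl
          obtain ⟨e, rfl⟩ := hne
          obtain ⟨f, l, hf, hl⟩ := hsurj e k
          have hf' : (G.src e, k) ∈ R f := ⟨hf.symm, l, hl⟩
          exact ⟨f, ⟨h.mem_toFinset.2 hf, hf'⟩, fun g hg => hdisj hg.2 hf'⟩ }, fun v => ?_⟩
  exact PEquiv.coordProj_ne_zero ⟨(v, Sum.inr 0), rfl⟩

lemma CStar.family_p_ne_zero (G : DirectedGraph V E) (v : V) : (CStar.family G).p v ≠ 0 := by
  obtain ⟨F, hF⟩ := G.exists_cuntzKriegerFamily_p_ne_zero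
  obtain ⟨φ, ⟨hφ, -⟩, -⟩ := CStar.universal G F
  exact fun h => hF v (by rw [← hφ, h, map_zero])

end DirectedGraph

/-! ### Countably generated, cyclic and irreducible representations -/

section

variable {A : Type w} [NonUnitalCStarAlgebra A]
  {H : Type x} [NormedAddCommGroup H] [InnerProductSpace ℂ H] [CompleteSpace H]
  {π : A →⋆ₙₐ[ℂ] (H →L[ℂ] H)}

lemma IsCyclicRep.isCountablyGeneratedRep (h : IsCyclicRep π) : IsCountablyGeneratedRep π :=
  let ⟨k, hk⟩ := h
  ⟨{k}, Set.countable_singleton k, hk⟩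

lemma apply_mem_repSpan {S : Set H} (a : A) {k : H} (hk : k ∈ repSpan π S) :
    π a k ∈ repSpan π S := by
  refine map_mem_closure (π a).continuous hk fun y hy => ?_
  induction hy using Submodule.span_induction with
  | mem y hy =>
    obtain ⟨b, h, hh, rfl⟩ := hy
    exact Submodule.subset_span ⟨a * b, h, hh, by rw [map_mul, mul_apply_eq_comp]⟩
  | zero => rw [map_zero]; exact Submodule.zero_mem _
  | add y z _ _ h1 h2 => rw [map_add]; exact Submodule.add_mem _ h1 h2
  | smul c y _ h => rw [map_smul]; exact Submodule.smul_mem _ c h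

lemma IsIrreducibleRep.isCyclicRep (h : IsIrreducibleRep π) {a : A} (ha : π a ≠ 0) :
    IsCyclicRep π := by
  obtain ⟨k, hk⟩ : ∃ k, π a k ≠ 0 := by
    by_contra! h0
    exact ha (ContinuousLinearMap.ext h0)
  refine ⟨k, (h (repSpan π {k}) (Submodule.isClosed_topologicalClosure _)
    fun a _ => apply_mem_repSpan a).resolve_left fun hbot => hk ?_⟩
  have : π a k ∈ repSpan π {k} :=
    Submodule.le_topologicalClosure _ (Submodule.subset_span ⟨a, k, rfl, rfl⟩)
  rwa [hbot, Submodule.mem_bot] at this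

end

namespace DirectedGraph

variable {V : Type u} {E : Type v} {G : DirectedGraph V E}
  {H : Type x} [NormedAddCommGroup H] [InnerProductSpace ℂ H] [CompleteSpace H]
  {π : G.CStar →⋆ₙₐ[ℂ] (H →L[ℂ] H)}

theorem CStar.countableSeparationProperty_of_isCountablyGeneratedRep
    (hπ : Function.Injective π) (hc : IsCountablyGeneratedRep π) :
    G.CountableSeparationProperty :=
  (CStar.family G).countableSeparationProperty_of_isCountablyGeneratedRep π
    (CStar.generated_family G) (CStar.family_p_ne_zero G) hπ hc

theorem CStar.countableSeparationProperty_of_isIrreducibleRep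
    (hπ : Function.Injective π) (hi : IsIrreducibleRep π) : G.CountableSeparationProperty := by
  -- For the empty graph `C⋆(G) = 0`, and its zero representation need not be cyclic.
  cases isEmpty_or_nonempty V with
  | inl _ => exact ⟨∅, Set.countable_empty, Subsingleton.elim _ _⟩
  | inr hV =>
    obtain ⟨v⟩ := hV
    refine countableSeparationProperty_of_isCountablyGeneratedRep hπ
      (hi.isCyclicRep (a := (CStar.family G).p v) fun h => ?_).isCountablyGeneratedRep
    exact CStar.family_p_ne_zero G v (hπ (h.trans (map_zero π).symm))

end DirectedGraph

theorem proposition3p5 {V : Type u} {E : Type v} (G : DirectedGraph V E) :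
    ((∃ (H : Type x) (_ : NormedAddCommGroup H) (_ : InnerProductSpace ℂ H) (_ : CompleteSpace H)
        (π : G.CStar →⋆ₙₐ[ℂ] (H →L[ℂ] H)), Function.Injective π ∧ IsCountablyGeneratedRep π) →
      G.CountableSeparationProperty) ∧
    ((∃ (H : Type x) (_ : NormedAddCommGroup H) (_ : InnerProductSpace ℂ H) (_ : CompleteSpace H)
        (π : G.CStar →⋆ₙₐ[ℂ] (H →L[ℂ] H)), Function.Injective π ∧ IsCyclicRep π) →
      G.CountableSeparationProperty) ∧
    (IsPrimitiveCStarAlgebra.{max u v + 1, x} G.CStar → G.CountableSeparationProperty) := by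
  refine ⟨?_, ?_, ?_⟩
  · rintro ⟨H, _, _, _, π, hπ, hc⟩
    exact DirectedGraph.CStar.countableSeparationProperty_of_isCountablyGeneratedRep hπ hc
  · rintro ⟨H, _, _, _, π, hπ, hc⟩
    exact DirectedGraph.CStar.countableSeparationProperty_of_isCountablyGeneratedRep hπ
      hc.isCountablyGeneratedRep
  · rintro ⟨H, _, _, _, π, hπ, hi⟩
    exact DirectedGraph.CStar.countableSeparationProperty_of_isIrreducibleRep hπ hi
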